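/- All systems are finite-dimensional, and $H(\sigma)=-\operatorname{Tr}\{\sigma\log\sigma\}$ is the von Neumann entropy (natural logarithm, $0\log 0=0$); entropies of subsystems are those of the corresponding reduced states, and $H(S|E)=H(SE)-H(E)$. For a state of $l$ systems put $$I(A_1:\cdots:A_l)_\rho=\sum_{i=1}^l H(A_i)_\rho-H(A_1\cdots A_l)_\rho ,\qquad I(A_1:\cdots:A_l|E)_\rho=\sum_{i=1}^l H(A_i|E)_\rho-H(A_1\cdots A_l|E)_\rho .$$ The multipartite squashed entanglement and the conditional entanglement of multipartite information (CEMI) of a state $\rho_{A_1\cdots A_l}$ are $$E_{\mathrm{sq}}(A_1:\cdots:A_l)_\rho=\tfrac12\inf_{\rho_{A_1\cdots A_lE}} I(A_1:\cdots:A_l|E)_\rho,$$ $$E_I(A_1:\cdots:A_l)_\rho=\tfrac12\inf_{\rho_{A_1A_1'\cdots A_lA_l'}}\bigl[I(A_1A_1':\cdots:A_lA_l')_\rho-I(A_1':\cdots:A_l')_\rho\bigr],$$ where the first infimum is over all states $\rho_{A_1\cdots A_lE}$ with $\operatorname{Tr}_E\rho_{A_1\cdots A_lE}=\rho_{A_1\cdots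 A_l}$, $E$ being a system of arbitrary finite dimension, and the second is over all states $\rho_{A_1A_1'\cdots A_lA_l'}$ with $\operatorname{Tr}_{A_1'\cdots A_l'}\rho_{A_1A_1'\cdots A_lA_l'}=\rho_{A_1\cdots A_l}$, the $A_i'$ being systems of arbitrary finite dimensions. **Proposition.** For every state $\rho_{A_1\cdots A_l}$, both infima are over nonempty sets of real numbers that are bounded below (so that $E_{\mathrm{sq}}$ and $E_I$ are well-defined real numbers), and $$E_{\mathrm{sq}}(A_1:\cdots:A_l)_\rho\le E_I(A_1:\cdots:A_l)_\rho .$$ -/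

import Mathlib

open scoped Matrix ComplexOrder

noncomputable section

/-- A state of a finite-dimensional quantum system whose Hilbert space has an orthonormal basis
labelled by `n`: a positive semidefinite matrix of trace one. A composite system is labelled by the
product of the label types of its parts. -/
@[ext]
structure DensityMatrix (n : Type*) [Fintype n] where
  /-- the underlying matrix -/
  mat : Matrix n n ℂ
  posSemidef : mat.PosSemidef
  trace_eq_one : mat.trace = 1

namespace DensityMatrix

section Basic

variable {m n : Type*} [Fintype m] [Fintype n]

/-- Relabelling of the basis along a bijection, used to regroup tensor factors. -/
def relabel (e : m ≃ n) (ρ : DensityMatrix m) : DensityMatrix n where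
  mat := ρ.mat.submatrix e.symm e.symm
  posSemidef := ρ.posSemidef.submatrix e.symm
  trace_eq_one := by
    rw [← ρ.trace_eq_one]
    exact Equiv.sum_comp e.symm fun i => ρ.mat i i

/-- Partial trace over the second factor: `(Tr₂ ρ) i j = ∑ k, ρ (i, k) (j, k)`. -/
def traceSnd (ρ : DensityMatrix (m × n)) : DensityMatrix m where
  mat := ∑ k, ρ.mat.submatrix (fun i => (i, k)) (fun i => (i, k))
  posSemidef := Matrix.posSemidef_sum _ fun k _ => ρ.posSemidef.submatrix _
  trace_eq_one := by
    rw [← ρ.trace_eq_one]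
    simp only [Matrix.trace, Matrix.diag, Matrix.sum_apply, Matrix.submatrix_apply,
      Fintype.sum_prod_type]

/-- Partial trace over the first factor. -/
def traceFst (ρ : DensityMatrix (m × n)) : DensityMatrix n :=
  (ρ.relabel (Equiv.prodComm m n)).traceSnd

/-- The von Neumann entropy `H(ρ) = -Tr(ρ log ρ)`, with the natural logarithm and `0 log 0 = 0`.
The logarithm is applied to `ρ` through its spectral decomposition. -/
def entropy [DecidableEq n] (ρ : DensityMatrix n) : ℝ :=
  -(ρ.mat * ρ.posSemidef.isHermitian.cfc Real.log).trace.re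

/-- The entropy is the Shannon entropy of the eigenvalues. -/
theorem entropy_eq_sum [DecidableEq n] (ρ : DensityMatrix n) :
    ρ.entropy = ∑ i, Real.negMulLog (ρ.posSemidef.isHermitian.eigenvalues i) := by
  have h := ρ.posSemidef.isHermitian
  have hmul : ρ.mat * h.cfc Real.log = h.cfc (fun x => x * Real.log x) := by
    rw [← h.cfc_eq, ← h.cfc_eq]
    have hc : ∀ f : ℝ → ℝ, ContinuousOn f (spectrum ℝ ρ.mat) :=
      fun f => (Matrix.finite_real_spectrum (A := ρ.mat)).continuousOn f
    rw [cfc_mul (fun x => x) Real.log ρ.mat (hc _) (hc _)]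
    congr 1
    exact (cfc_id' ℝ ρ.mat h).symm
  rw [entropy, hmul, Matrix.IsHermitian.cfc, Unitary.conjStarAlgAut_apply,
    Matrix.trace_mul_cycle, Unitary.coe_star_mul_self, one_mul, Matrix.trace_diagonal]
  simp [Real.negMulLog]

/-- The conditional entropy `H(S|E) = H(SE) - H(E)` of a state of `S ⊗ E`. -/
def condEntropy [DecidableEq m] [DecidableEq n] (ρ : DensityMatrix (m × n)) : ℝ :=
  ρ.entropy - ρ.traceFst.entropy

end Basic

section Multipartite

variable {l : ℕ} {α : Fin l → Type*} [∀ i, Fintype (α i)] [∀ i, DecidableEq (α i)]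

/-- The reduced state of the `i`-th system: all the other systems are traced out. -/
def marginal (ρ : DensityMatrix (∀ j, α j)) (i : Fin l) : DensityMatrix (α i) :=
  (ρ.relabel (Equiv.piSplitAt i α)).traceSnd

/-- The multipartite information `I(A₁ : ⋯ : A_l) = ∑ᵢ H(Aᵢ) - H(A₁ ⋯ A_l)`. -/
def multiInfo (ρ : DensityMatrix (∀ j, α j)) : ℝ :=
  (∑ i, (ρ.marginal i).entropy) - ρ.entropy

/-- Regrouping `(A₁ ⋯ A_l) E` as `(Aᵢ E) (rest)`. -/
def splitAtWith (α : Fin l → Type*) (ε : Type*) (i : Fin l) :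
    (∀ j, α j) × ε ≃ (α i × ε) × (∀ j : {j // j ≠ i}, α j) :=
  ((Equiv.piSplitAt i α).prodCongr (Equiv.refl ε)).trans
    { toFun := fun p => ((p.1.1, p.2), p.1.2)
      invFun := fun q => ((q.1.1, q.2), q.1.2)
      left_inv := fun _ => rfl
      right_inv := fun _ => rfl }

/-- The reduced state of `Aᵢ E`, for a state of `A₁ ⋯ A_l E`. -/
def marginalWith {ε : Type*} [Fintype ε] (σ : DensityMatrix ((∀ j, α j) × ε)) (i : Fin l) :
    DensityMatrix (α i × ε) :=
  (σ.relabel (splitAtWith α ε i)).traceSnd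

/-- The conditional multipartite information
`I(A₁ : ⋯ : A_l | E) = ∑ᵢ H(Aᵢ|E) - H(A₁ ⋯ A_l|E)`. -/
def condMultiInfo {ε : Type*} [Fintype ε] [DecidableEq ε]
    (σ : DensityMatrix ((∀ j, α j) × ε)) : ℝ :=
  (∑ i, (σ.marginalWith i).condEntropy) - σ.condEntropy

/-- The values `I(A₁ : ⋯ : A_l | E)` over all extensions of `ρ` to `A₁ ⋯ A_l E`, where `E` is a
system of arbitrary finite dimension. -/
def squashedValues (ρ : DensityMatrix (∀ j, α j)) : Set ℝ :=
  {x | ∃ (e : ℕ) (σ : DensityMatrix ((∀ j, α j) × Fin e)),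
    σ.traceSnd = ρ ∧ x = σ.condMultiInfo}

/-- The multipartite squashed entanglement `E_sq(A₁ : ⋯ : A_l)`. -/
def squashedEntanglement (ρ : DensityMatrix (∀ j, α j)) : ℝ :=
  1 / 2 * sInf ρ.squashedValues

variable {β : Fin l → Type*} [∀ i, Fintype (β i)]

/-- The reduced state of `A₁ ⋯ A_l`, for a state of `A₁A₁' ⋯ A_lA_l'`. -/
def unprimed (σ : DensityMatrix (∀ j, α j × β j)) : DensityMatrix (∀ j, α j) :=
  (σ.relabel (Equiv.arrowProdEquivProdArrow (Fin l) α β)).traceSnd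

/-- The reduced state of `A₁' ⋯ A_l'`, for a state of `A₁A₁' ⋯ A_lA_l'`. -/
def primed [∀ i, DecidableEq (β i)] (σ : DensityMatrix (∀ j, α j × β j)) :
    DensityMatrix (∀ j, β j) :=
  (σ.relabel (Equiv.arrowProdEquivProdArrow (Fin l) α β)).traceFst

/-- The values `I(A₁A₁' : ⋯ : A_lA_l') - I(A₁' : ⋯ : A_l')` over all extensions of `ρ` to
`A₁A₁' ⋯ A_lA_l'`, where the `Aᵢ'` are systems of arbitrary finite dimensions. -/
def cemiValues (ρ : DensityMatrix (∀ j, α j)) : Set ℝ :=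
  {x | ∃ (d : Fin l → ℕ) (σ : DensityMatrix (∀ j, α j × Fin (d j))),
    σ.unprimed = ρ ∧ x = σ.multiInfo - σ.primed.multiInfo}

/-- The conditional entanglement of multipartite information `E_I(A₁ : ⋯ : A_l)`. -/
def cemi (ρ : DensityMatrix (∀ j, α j)) : ℝ :=
  1 / 2 * sInf ρ.cemiValues

end Multipartite

end DensityMatrix

end

/-!
An extension `σ` of `ρ` to `A₁A₁' ⋯ A_lA_l'` is also an extension to `A₁ ⋯ A_l E` with
`E = A₁' ⋯ A_l'`, and in terms of it
`I(A₁A₁' : ⋯ : A_lA_l') - I(A₁' : ⋯ : A_l') - I(A₁ : ⋯ : A_l | E)`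
`= ∑ᵢ (H(Aᵢ | Aᵢ') - H(Aᵢ | A₁' ⋯ A_l'))`.
Every summand is nonnegative by strong subadditivity
(`DensityMatrix.condEntropy_le_condEntropy_traceSnd`), so every value in the infimum defining CEMI
dominates a value in the infimum defining the squashed entanglement. The latter values are bounded
below because `-log |A| ≤ H(A|E) ≤ |A|`, whatever the dimension of `E`.

Strong subadditivity is the monotonicity under a partial trace over `c` of the relative entropy of
`ρ` on `a b c` to `σ = 1 ⊗ (ρ_bc + ε)`, in the limit `ε → 0`. For `σ` positive definite, the
relative entropy is the integral over `s` in `(0, ∞)` of `Tr (ρ (L_σ + s R_ρ)⁻¹ ρ) - 1 / (1 + s)`,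
where `L_σ` and `R_ρ` are left and right multiplication. The trace in the integrand is the maximum
over all matrices `X` of the functional
`2 Re Tr (Xᴴ ρ) - Tr (Xᴴ σ X) - s Tr (X ρ Xᴴ)` (`Matrix.resolventForm`), and replacing `ρ` and `σ`
by their partial traces amounts to restricting `X` to the matrices `Y ⊗ 1`
(`Matrix.resolventForm_partialTrace`). The lower bound on `H(A|E)` comes from the same functional
and the operator inequality `ρ_AE ≤ |A| • (1 ⊗ ρ_E)`. In eigenbases of `ρ` and `σ` all of this is
explicit, and no operator monotonicity or convexity is needed.
-/

noncomputable section

open scoped Kronecker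
open Filter Topology Matrix

/-! ### The scalar inequality -/

theorem hasDerivAt_mul_log_add {p q s : ℝ} (hp : 0 ≤ p) (hq : 0 < q) (hs : 0 ≤ s) :
    HasDerivAt (fun s => p * Real.log (q + s * p)) (p ^ 2 / (q + s * p)) s := by
  have hpos : 0 < q + s * p := by positivity
  have h1 : HasDerivAt (fun s => q + s * p) p s := by
    simpa using ((hasDerivAt_id s).mul_const p).const_add q
  have h2 := (h1.log hpos.ne').const_mul p
  exact h2.congr_deriv (by ring)

theorem tendsto_mul_log_add_sub {p q : ℝ} (hp : 0 ≤ p) :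
    Tendsto (fun N : ℝ => p * Real.log (q + N * p) - p * Real.log N) atTop
      (𝓝 (p * Real.log p)) := by
  rcases hp.eq_or_lt with rfl | hp
  · simp
  have h1 : Tendsto (fun N : ℝ => p * Real.log (q / N + p)) atTop (𝓝 (p * Real.log p)) := by
    have : Tendsto (fun N : ℝ => q / N + p) atTop (𝓝 (0 + p)) :=
      (tendsto_const_nhds.div_atTop tendsto_id).add tendsto_const_nhds
    rw [zero_add] at this
    exact (this.log hp.ne').const_mul p
  refine h1.congr' ?_
  have hlarge : Tendsto (fun N : ℝ => q + N * p) atTop atTop :=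
    tendsto_atTop_add_const_left _ _ (tendsto_id.atTop_mul_const hp)
  filter_upwards [hlarge.eventually_gt_atTop 0, eventually_gt_atTop 0] with N h1 h2
  rw [← mul_sub, ← Real.log_div h1.ne' h2.ne']
  congr 2
  field_simp

/-- A comparison of the rational sums `∑ c p² / (q + s p)` for all `s > 0` integrates to a
comparison of the relative entropies `∑ c (p log p - p log q)`. Indeed the integral over `[0, N]`
is `∑ c p (log (q + N p) - log q)`, which is `∑ c (p log p - p log q) + (∑ c p) log N + o(1)`. -/
theorem sum_mul_log_le_of_resolvent_le {ι κ : Type*} [Fintype ι] [Fintype κ]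
    {c p q : ι → ℝ} {c' p' q' : κ → ℝ}
    (hp : ∀ i, 0 ≤ p i) (hq : ∀ i, 0 < q i) (hp' : ∀ i, 0 ≤ p' i) (hq' : ∀ i, 0 < q' i)
    (hsum : ∑ i, c' i * p' i = ∑ i, c i * p i)
    (h : ∀ s, 0 < s → ∑ i, c' i * (p' i ^ 2 / (q' i + s * p' i)) ≤
      ∑ i, c i * (p i ^ 2 / (q i + s * p i))) :
    ∑ i, c' i * (p' i * Real.log (p' i) - p' i * Real.log (q' i)) ≤
      ∑ i, c i * (p i * Real.log (p i) - p i * Real.log (q i)) := by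
  set f : ℝ → ℝ := fun s => ∑ i, c i * (p i * Real.log (q i + s * p i)) with hf
  set f' : ℝ → ℝ := fun s => ∑ i, c' i * (p' i * Real.log (q' i + s * p' i)) with hf'
  have hd : ∀ s, 0 ≤ s → HasDerivAt f (∑ i, c i * (p i ^ 2 / (q i + s * p i))) s := fun s hs =>
    HasDerivAt.fun_sum fun i _ => (hasDerivAt_mul_log_add (hp i) (hq i) hs).const_mul (c i)
  have hd' : ∀ s, 0 ≤ s → HasDerivAt f' (∑ i, c' i * (p' i ^ 2 / (q' i + s * p' i))) s :=
    fun s hs => HasDerivAt.fun_sum fun i _ =>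
      (hasDerivAt_mul_log_add (hp' i) (hq' i) hs).const_mul (c' i)
  -- Instead of an integral over `[0, N]`: the difference of the primitives is monotone.
  have hmono : MonotoneOn (f - f') (Set.Ici 0) := by
    refine monotoneOn_of_deriv_nonneg (convex_Ici 0) (fun s hs => ?_) (fun s hs => ?_) fun s hs => ?_
    · exact ((hd s hs).sub (hd' s hs)).continuousAt.continuousWithinAt
    · rw [interior_Ici] at hs
      exact ((hd s hs.le).sub (hd' s hs.le)).differentiableAt.differentiableWithinAt
    · rw [interior_Ici] at hs
      rw [((hd s hs.le).sub (hd' s hs.le)).deriv]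
      exact sub_nonneg.2 (h s hs)
  have hlim : Tendsto (fun N => f N - f 0 - (∑ i, c i * p i) * Real.log N) atTop
      (𝓝 (∑ i, c i * (p i * Real.log (p i) - p i * Real.log (q i)))) := by
    have : Tendsto (fun N : ℝ => ∑ i, c i * ((p i * Real.log (q i + N * p i) - p i * Real.log N)
        - p i * Real.log (q i))) atTop
        (𝓝 (∑ i, c i * (p i * Real.log (p i) - p i * Real.log (q i)))) :=
      tendsto_finsetSum _ fun i _ =>
        ((tendsto_mul_log_add_sub (hp i)).sub_const _).const_mul _
    refine this.congr fun N => ?_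
    simp only [hf, zero_mul, add_zero, Finset.sum_mul, ← Finset.sum_sub_distrib]
    exact Finset.sum_congr rfl fun i _ => by ring
  have hlim' : Tendsto (fun N => f' N - f' 0 - (∑ i, c i * p i) * Real.log N) atTop
      (𝓝 (∑ i, c' i * (p' i * Real.log (p' i) - p' i * Real.log (q' i)))) := by
    have : Tendsto (fun N : ℝ => ∑ i, c' i * ((p' i * Real.log (q' i + N * p' i) -
        p' i * Real.log N) - p' i * Real.log (q' i))) atTop
        (𝓝 (∑ i, c' i * (p' i * Real.log (p' i) - p' i * Real.log (q' i)))) :=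
      tendsto_finsetSum _ fun i _ =>
        ((tendsto_mul_log_add_sub (hp' i)).sub_const _).const_mul _
    refine this.congr fun N => ?_
    simp only [hf', ← hsum, zero_mul, add_zero, Finset.sum_mul, ← Finset.sum_sub_distrib]
    exact Finset.sum_congr rfl fun i _ => by ring
  refine le_of_tendsto_of_tendsto hlim' hlim ?_
  filter_upwards [eventually_ge_atTop 0] with N hN
  have := hmono (Set.mem_Ici.2 le_rfl) hN hN
  simp only [Pi.sub_apply] at this
  linarith

/-! ### The resolvent functional and its maximum -/

namespace Matrix

variable {n : Type*} [Fintype n]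

/-- The functional `X ↦ 2 Re Tr (Xᴴ ρ) - Tr (Xᴴ σ X) - s Tr (X ρ Xᴴ)`. For `ρ` positive
semidefinite, `σ` positive definite and `s > 0` it is concave with maximum
`Tr (ρ (L_σ + s R_ρ)⁻¹ ρ)`, where `L_σ` and `R_ρ` are the multiplications by `σ` on the left and by
`ρ` on the right. -/
def resolventForm (s : ℝ) (ρ σ X : Matrix n n ℂ) : ℝ :=
  2 * (Xᴴ * ρ).trace.re - (Xᴴ * σ * X).trace.re - s * (X * ρ * Xᴴ).trace.re

variable [DecidableEq n]

/-- The squared overlap `|⟨v_j, u_i⟩|²` of the `j`-th column of `V` with the `i`-th column of `U`,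
as a function of the pair `(j, i)`. -/
def overlap (U V : Matrix n n ℂ) (x : n × n) : ℝ := Complex.normSq ((Vᴴ * U) x.1 x.2)

/-- In eigenbases of `ρ` and `σ` the functional splits into a sum of quadratic polynomials, one for
each entry of `X`. -/
theorem resolventForm_conj {U V : Matrix n n ℂ} (hU : U ∈ unitaryGroup n ℂ)
    (hV : V ∈ unitaryGroup n ℂ) (p q : n → ℝ) (s : ℝ) (Z : Matrix n n ℂ) :
    resolventForm s (U * diagonal (fun i => (p i : ℂ)) * Uᴴ)
      (V * diagonal (fun i => (q i : ℂ)) * Vᴴ) (V * Z * Uᴴ) =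
    ∑ x : n × n, (2 * (star (Z x.1 x.2) * (Vᴴ * U) x.1 x.2).re * p x.2 -
      Complex.normSq (Z x.1 x.2) * (q x.1 + s * p x.2)) := by
  have hU' : Uᴴ * U = 1 := mem_unitaryGroup_iff'.1 hU
  have hV' : Vᴴ * V = 1 := mem_unitaryGroup_iff'.1 hV
  set P : Matrix n n ℂ := diagonal (fun i => (p i : ℂ))
  set Q : Matrix n n ℂ := diagonal (fun i => (q i : ℂ))
  have e1 : ((V * Z * Uᴴ)ᴴ * (U * P * Uᴴ)).trace = (Zᴴ * ((Vᴴ * U) * P)).trace := by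
    have : (V * Z * Uᴴ)ᴴ * (U * P * Uᴴ) = U * (Zᴴ * (Vᴴ * U) * P * Uᴴ) := by
      simp only [conjTranspose_mul, conjTranspose_conjTranspose, Matrix.mul_assoc]
    rw [this, trace_mul_comm]
    simp only [Matrix.mul_assoc, hU', Matrix.mul_one]
  have e2 : ((V * Z * Uᴴ)ᴴ * (V * Q * Vᴴ) * (V * Z * Uᴴ)).trace = (Zᴴ * (Q * Z)).trace := by
    have : (V * Z * Uᴴ)ᴴ * (V * Q * Vᴴ) * (V * Z * Uᴴ) =
        U * (Zᴴ * (Vᴴ * V) * Q * (Vᴴ * V) * Z * Uᴴ) := by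
      simp only [conjTranspose_mul, conjTranspose_conjTranspose, Matrix.mul_assoc]
    rw [this, trace_mul_comm, hV']
    simp only [Matrix.mul_assoc, hU', Matrix.mul_one]
  have e3 : ((V * Z * Uᴴ) * (U * P * Uᴴ) * (V * Z * Uᴴ)ᴴ).trace = (Zᴴ * (Z * P)).trace := by
    have : (V * Z * Uᴴ) * (U * P * Uᴴ) * (V * Z * Uᴴ)ᴴ =
        V * (Z * (Uᴴ * U) * P * (Uᴴ * U) * Zᴴ * Vᴴ) := by
      simp only [conjTranspose_mul, conjTranspose_conjTranspose, Matrix.mul_assoc]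
    rw [this, trace_mul_comm, hU']
    simp only [Matrix.mul_assoc, hV', Matrix.mul_one]
    rw [← Matrix.mul_assoc, trace_mul_comm]
  have key : ∀ A : Matrix n n ℂ, (Zᴴ * A).trace.re =
      ∑ x : n × n, (star (Z x.1 x.2) * A x.1 x.2).re := fun A => by
    rw [Fintype.sum_prod_type_right, trace]
    simp [mul_apply, conjTranspose_apply]
  rw [resolventForm, e1, e2, e3, key, key, key, Finset.mul_sum, Finset.mul_sum,
    ← Finset.sum_sub_distrib, ← Finset.sum_sub_distrib]
  refine Finset.sum_congr rfl fun x _ => ?_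
  simp only [P, Q, mul_diagonal, diagonal_mul, Complex.normSq_apply]
  simp
  ring

theorem resolventForm_le {U V : Matrix n n ℂ} (hU : U ∈ unitaryGroup n ℂ)
    (hV : V ∈ unitaryGroup n ℂ) {p q : n → ℝ} (hp : ∀ i, 0 ≤ p i) (hq : ∀ i, 0 < q i) {s : ℝ}
    (hs : 0 < s) (X : Matrix n n ℂ) :
    resolventForm s (U * diagonal (fun i => (p i : ℂ)) * Uᴴ)
      (V * diagonal (fun i => (q i : ℂ)) * Vᴴ) X ≤
    ∑ x, overlap U V x * (p x.2 ^ 2 / (q x.1 + s * p x.2)) := by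
  have hU' : U * Uᴴ = 1 := mem_unitaryGroup_iff.1 hU
  have hV' : V * Vᴴ = 1 := mem_unitaryGroup_iff.1 hV
  obtain ⟨Z, rfl⟩ : ∃ Z, X = V * Z * Uᴴ := ⟨Vᴴ * X * U, by
    rw [Matrix.mul_assoc, Matrix.mul_assoc, Matrix.mul_assoc, hU', Matrix.mul_one,
      ← Matrix.mul_assoc, hV', Matrix.one_mul]⟩
  rw [resolventForm_conj hU hV]
  refine Finset.sum_le_sum fun x _ => ?_
  have hr : 0 < q x.1 + s * p x.2 :=
    add_pos_of_pos_of_nonneg (hq _) (mul_nonneg hs.le (hp _))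
  -- Completing the square in the entry of `Z`.
  set r := q x.1 + s * p x.2
  set z := Z x.1 x.2
  set w := (Vᴴ * U) x.1 x.2
  set a := p x.2
  have : overlap U V x * (a ^ 2 / r) - (2 * (star z * w).re * a - Complex.normSq z * r) =
      ((z.re * r - w.re * a) ^ 2 + (z.im * r - w.im * a) ^ 2) / r := by
    change Complex.normSq w * _ - _ = _
    simp only [Complex.normSq_apply]
    simp
    field_simp
    ring
  have h0 : 0 ≤ ((z.re * r - w.re * a) ^ 2 + (z.im * r - w.im * a) ^ 2) / r := by positivity
  linarith

theorem exists_resolventForm_eq {U V : Matrix n n ℂ} (hU : U ∈ unitaryGroup n ℂ)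
    (hV : V ∈ unitaryGroup n ℂ) {p q : n → ℝ} (hp : ∀ i, 0 ≤ p i) (hq : ∀ i, 0 < q i) {s : ℝ}
    (hs : 0 < s) : ∃ X,
    resolventForm s (U * diagonal (fun i => (p i : ℂ)) * Uᴴ)
      (V * diagonal (fun i => (q i : ℂ)) * Vᴴ) X =
    ∑ x, overlap U V x * (p x.2 ^ 2 / (q x.1 + s * p x.2)) := by
  refine ⟨V * (of fun j i => (Vᴴ * U) j i * ((p i / (q j + s * p i) : ℝ) : ℂ)) * Uᴴ, ?_⟩
  rw [resolventForm_conj hU hV]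
  refine Finset.sum_congr rfl fun x _ => ?_
  have hr : 0 < q x.1 + s * p x.2 :=
    add_pos_of_pos_of_nonneg (hq _) (mul_nonneg hs.le (hp _))
  simp only [of_apply, overlap]
  set r := q x.1 + s * p x.2
  set w := (Vᴴ * U) x.1 x.2
  set a := p x.2
  have h1 : (star (w * ((a / r : ℝ) : ℂ)) * w).re = Complex.normSq w * (a / r) := by
    simp only [Complex.normSq_apply, star_mul', Complex.star_def, Complex.conj_ofReal,
      Complex.mul_re, Complex.mul_im, Complex.conj_re, Complex.conj_im, Complex.ofReal_re,
      Complex.ofReal_im]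
    ring
  rw [h1, Complex.normSq_mul, Complex.normSq_ofReal]
  field_simp
  ring

theorem sum_overlap_mul {U V : Matrix n n ℂ} (p f : n → ℝ) :
    ∑ x, overlap U V x * (p x.2 * f x.1) =
      ∑ j, ((Vᴴ * (U * diagonal (fun i => (p i : ℂ)) * Uᴴ) * V) j j).re * f j := by
  rw [Fintype.sum_prod_type]
  refine Finset.sum_congr rfl fun j _ => ?_
  have : Vᴴ * (U * diagonal (fun i => (p i : ℂ)) * Uᴴ) * V =
      (Vᴴ * U) * diagonal (fun i => (p i : ℂ)) * (Vᴴ * U)ᴴ := by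
    simp only [conjTranspose_mul, conjTranspose_conjTranspose, Matrix.mul_assoc]
  rw [this, mul_apply, Complex.re_sum, Finset.sum_mul]
  refine Finset.sum_congr rfl fun i _ => ?_
  simp only [overlap, mul_diagonal, conjTranspose_apply, Complex.normSq_apply]
  simp
  ring

theorem sum_overlap_mul_right {U V : Matrix n n ℂ} (hU : U ∈ unitaryGroup n ℂ)
    (hV : V ∈ unitaryGroup n ℂ) (f : n → ℝ) :
    ∑ x, overlap U V x * f x.2 = ∑ i, f i := by
  rw [Fintype.sum_prod_type_right]
  refine Finset.sum_congr rfl fun i _ => ?_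
  change ∑ j, overlap U V (j, i) * f i = f i
  rw [← Finset.sum_mul]
  have hW : (Vᴴ * U)ᴴ * (Vᴴ * U) = 1 := by
    rw [conjTranspose_mul, conjTranspose_conjTranspose, Matrix.mul_assoc, ← Matrix.mul_assoc V,
      show V * Vᴴ = 1 from mem_unitaryGroup_iff.1 hV, Matrix.one_mul]
    exact mem_unitaryGroup_iff'.1 hU
  have h := congr_arg Complex.re (congr_fun (congr_fun hW i) i)
  rw [mul_apply, Complex.re_sum, one_apply_eq, Complex.one_re] at h
  convert one_mul (f i)
  rw [← h]
  refine Finset.sum_congr rfl fun j _ => ?_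
  simp [overlap, conjTranspose_apply, Complex.normSq_apply]

end Matrix

/-! ### Relative entropy and conditional entropy from the resolvent functional -/

namespace DensityMatrix

section PartialTrace

variable {m n : Type*} [Fintype m] [Fintype n]

theorem traceFst_mat_apply (ρ : DensityMatrix (m × n)) (i j : n) :
    ρ.traceFst.mat i j = ∑ a, ρ.mat (a, i) (a, j) := by
  simp [traceFst, traceSnd, relabel, Matrix.sum_apply]

theorem traceSnd_mat_apply (ρ : DensityMatrix (m × n)) (i j : m) :
    ρ.traceSnd.mat i j = ∑ k, ρ.mat (i, k) (j, k) := by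
  simp [traceSnd, Matrix.sum_apply]

theorem nonempty (ρ : DensityMatrix m) : Nonempty m := by
  by_contra h
  rw [not_nonempty_iff] at h
  have := ρ.trace_eq_one
  simp [Matrix.trace] at this

end PartialTrace

section Spectral

variable {n n' : Type*} [Fintype n] [DecidableEq n] [Fintype n'] [DecidableEq n']

/-- The eigenvalues of a state, with multiplicity. -/
def eigenvalues (ρ : DensityMatrix n) : n → ℝ := ρ.posSemidef.isHermitian.eigenvalues

/-- A unitary whose columns are eigenvectors of the state, in the order of `eigenvalues`. -/
def eigenvectors (ρ : DensityMatrix n) : Matrix n n ℂ :=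
  ρ.posSemidef.isHermitian.eigenvectorUnitary

theorem eigenvalues_nonneg (ρ : DensityMatrix n) (i : n) : 0 ≤ ρ.eigenvalues i :=
  ρ.posSemidef.eigenvalues_nonneg i

theorem eigenvectors_mem (ρ : DensityMatrix n) : ρ.eigenvectors ∈ unitaryGroup n ℂ :=
  ρ.posSemidef.isHermitian.eigenvectorUnitary.2

theorem mat_eq (ρ : DensityMatrix n) :
    ρ.mat = ρ.eigenvectors * diagonal (fun i => (ρ.eigenvalues i : ℂ)) * ρ.eigenvectorsᴴ := by
  have := ρ.posSemidef.isHermitian.spectral_theorem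
  rwa [Unitary.conjStarAlgAut_apply] at this

theorem conjTranspose_eigenvectors_mul_mat_mul (ρ : DensityMatrix n) :
    ρ.eigenvectorsᴴ * ρ.mat * ρ.eigenvectors = diagonal (fun i => (ρ.eigenvalues i : ℂ)) := by
  have h : ρ.eigenvectorsᴴ * ρ.eigenvectors = 1 := mem_unitaryGroup_iff'.1 ρ.eigenvectors_mem
  rw [ρ.mat_eq, Matrix.mul_assoc, Matrix.mul_assoc, Matrix.mul_assoc, h, Matrix.mul_one,
    ← Matrix.mul_assoc, h, Matrix.one_mul]

theorem sum_eigenvalues (ρ : DensityMatrix n) : ∑ i, ρ.eigenvalues i = 1 := by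
  have h := ρ.posSemidef.isHermitian.trace_eq_sum_eigenvalues
  rw [ρ.trace_eq_one] at h
  have := congr_arg Complex.re h
  simpa [eigenvalues] using this.symm

theorem eigenvalues_le_one (ρ : DensityMatrix n) (i : n) : ρ.eigenvalues i ≤ 1 :=
  ρ.sum_eigenvalues ▸ Finset.single_le_sum (fun j _ => ρ.eigenvalues_nonneg j) (Finset.mem_univ i)

theorem entropy_eq (ρ : DensityMatrix n) : ρ.entropy = ∑ i, Real.negMulLog (ρ.eigenvalues i) :=
  ρ.entropy_eq_sum

theorem entropy_nonneg (ρ : DensityMatrix n) : 0 ≤ ρ.entropy := by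
  rw [entropy_eq]
  exact Finset.sum_nonneg fun i _ =>
    Real.negMulLog_nonneg (ρ.eigenvalues_nonneg i) (ρ.eigenvalues_le_one i)

theorem entropy_le_card (ρ : DensityMatrix n) : ρ.entropy ≤ Fintype.card n := by
  rw [entropy_eq, ← mul_one (Fintype.card n : ℝ), ← nsmul_eq_mul, ← Finset.card_univ]
  refine Finset.sum_le_card_nsmul _ _ _ fun i _ => ?_
  have h := Real.negMulLog_le_one_sub_self (ρ.eigenvalues_nonneg i)
  linarith [ρ.eigenvalues_nonneg i]

theorem entropy_relabel (e : n ≃ n') (ρ : DensityMatrix n) :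
    (ρ.relabel e).entropy = ρ.entropy := by
  have h := (ρ.relabel e).posSemidef.isHermitian.roots_charpoly_eq_eigenvalues
  have hc : (ρ.relabel e).mat.charpoly = ρ.mat.charpoly := charpoly_reindex e ρ.mat
  rw [hc, ρ.posSemidef.isHermitian.roots_charpoly_eq_eigenvalues] at h
  have := congr_arg (fun M => (M.map fun z : ℂ => Real.negMulLog z.re).sum) h
  rw [entropy_eq_sum, entropy_eq_sum]
  simpa [Multiset.map_map, Function.comp_def] using this.symm

/-- The left side is the relative entropy `Tr (ρ log ρ) - Tr (ρ log σ)` for `σ = V diag(q) Vᴴ`. -/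
theorem relEntropy_eq_sum_overlap (ρ : DensityMatrix n) {V : Matrix n n ℂ}
    (hV : V ∈ unitaryGroup n ℂ) (q : n → ℝ) :
    -ρ.entropy - ∑ j, ((Vᴴ * ρ.mat * V) j j).re * Real.log (q j) =
      ∑ x, overlap ρ.eigenvectors V x * (ρ.eigenvalues x.2 * Real.log (ρ.eigenvalues x.2) -
        ρ.eigenvalues x.2 * Real.log (q x.1)) := by
  simp only [mul_sub, Finset.sum_sub_distrib]
  rw [sum_overlap_mul_right ρ.eigenvectors_mem hV
    (fun i => ρ.eigenvalues i * Real.log (ρ.eigenvalues i)),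
    sum_overlap_mul ρ.eigenvalues (fun j => Real.log (q j)), ← ρ.mat_eq, entropy_eq]
  simp [Real.negMulLog]

/-- The relative entropy of `ρ'` to `V' diag(q') V'ᴴ` is at most that of `ρ` to `V diag(q) Vᴴ` as
soon as the maxima of the corresponding functionals `resolventForm s` are so ordered for every
`s > 0`. -/
theorem relEntropy_le_of_resolventForm_le (ρ : DensityMatrix n) (ρ' : DensityMatrix n')
    {V : Matrix n n ℂ} {V' : Matrix n' n' ℂ} (hV : V ∈ unitaryGroup n ℂ)
    (hV' : V' ∈ unitaryGroup n' ℂ) {q : n → ℝ} {q' : n' → ℝ} (hq : ∀ i, 0 < q i)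
    (hq' : ∀ i, 0 < q' i)
    (h : ∀ s, 0 < s → ∀ Y, ∃ X,
      resolventForm s ρ'.mat (V' * diagonal (fun i => (q' i : ℂ)) * V'ᴴ) Y ≤
        resolventForm s ρ.mat (V * diagonal (fun i => (q i : ℂ)) * Vᴴ) X) :
    -ρ'.entropy - ∑ j, ((V'ᴴ * ρ'.mat * V') j j).re * Real.log (q' j) ≤
      -ρ.entropy - ∑ j, ((Vᴴ * ρ.mat * V) j j).re * Real.log (q j) := by
  rw [ρ'.relEntropy_eq_sum_overlap hV', ρ.relEntropy_eq_sum_overlap hV]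
  refine sum_mul_log_le_of_resolvent_le (fun x => ρ.eigenvalues_nonneg _) (fun x => hq _)
    (fun x => ρ'.eigenvalues_nonneg _) (fun x => hq' _) ?_ fun s hs => ?_
  · rw [sum_overlap_mul_right ρ.eigenvectors_mem hV, sum_overlap_mul_right ρ'.eigenvectors_mem hV',
      sum_eigenvalues, sum_eigenvalues]
  · obtain ⟨Y, hY⟩ := exists_resolventForm_eq ρ'.eigenvectors_mem hV' ρ'.eigenvalues_nonneg hq' hs
    obtain ⟨X, hX⟩ := h s hs Y
    rw [← hY, ← ρ'.mat_eq]
    refine hX.trans ?_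
    conv_lhs => rw [ρ.mat_eq]
    exact resolventForm_le ρ.eigenvectors_mem hV ρ.eigenvalues_nonneg hq hs X

/-- The regularised entropy `-Tr (ρ log (ρ + ε))`. -/
def regEntropy (ρ : DensityMatrix n) (ε : ℝ) : ℝ :=
  -∑ i, ρ.eigenvalues i * Real.log (ρ.eigenvalues i + ε)

theorem tendsto_regEntropy (ρ : DensityMatrix n) :
    Tendsto ρ.regEntropy (𝓝[>] 0) (𝓝 ρ.entropy) := by
  have : ρ.entropy = -∑ i, ρ.eigenvalues i * Real.log (ρ.eigenvalues i) := by
    rw [entropy_eq]; simp [Real.negMulLog]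
  rw [this]
  refine (tendsto_finsetSum _ fun i _ => ?_).neg
  rcases (ρ.eigenvalues_nonneg i).eq_or_lt with h | h
  · simp [← h]
  · have : Tendsto (fun ε : ℝ => ρ.eigenvalues i + ε) (𝓝 0) (𝓝 (ρ.eigenvalues i)) := by
      simpa using (tendsto_id (x := 𝓝 (0 : ℝ))).const_add (ρ.eigenvalues i)
    exact ((this.log h.ne').const_mul _).mono_left nhdsWithin_le_nhds

end Spectral

section Conditional

variable {m n m' n' : Type*} [Fintype m] [Fintype n] [DecidableEq m] [DecidableEq n]
  [Fintype m'] [Fintype n'] [DecidableEq m'] [DecidableEq n']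

/-- The regularised reference operator `1 ⊗ (ρ_n + ε)` of a state `ρ` of `m × n`, where `ρ_n` is the
reduced state. The relative entropy of `ρ` to it tends to `-H(m|n)` as `ε → 0`. -/
def condRef (ρ : DensityMatrix (m × n)) (ε : ℝ) : Matrix (m × n) (m × n) ℂ :=
  (1 : Matrix m m ℂ) ⊗ₖ (ρ.traceFst.mat + (ε : ℂ) • (1 : Matrix n n ℂ))

/-- A unitary whose columns are eigenvectors of `condRef`. -/
def condVec (ρ : DensityMatrix (m × n)) : Matrix (m × n) (m × n) ℂ :=
  (1 : Matrix m m ℂ) ⊗ₖ ρ.traceFst.eigenvectors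

theorem condVec_mem (ρ : DensityMatrix (m × n)) : ρ.condVec ∈ unitaryGroup (m × n) ℂ :=
  kronecker_mem_unitary (one_mem _) ρ.traceFst.eigenvectors_mem

theorem condRef_eq (ρ : DensityMatrix (m × n)) (ε : ℝ) :
    ρ.condRef ε = ρ.condVec *
      diagonal (fun i => ((ρ.traceFst.eigenvalues i.2 + ε : ℝ) : ℂ)) * ρ.condVecᴴ := by
  have hd : diagonal (fun i : m × n => ((ρ.traceFst.eigenvalues i.2 + ε : ℝ) : ℂ)) =
      (1 : Matrix m m ℂ) ⊗ₖ (diagonal (fun i => (ρ.traceFst.eigenvalues i : ℂ)) +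
        (ε : ℂ) • (1 : Matrix n n ℂ)) := by
    rw [← diagonal_one, ← diagonal_one, ← diagonal_smul, diagonal_add,
      diagonal_kronecker_diagonal]
    simp
  have hT : ρ.traceFst.eigenvectors * ρ.traceFst.eigenvectorsᴴ = 1 :=
    mem_unitaryGroup_iff.1 ρ.traceFst.eigenvectors_mem
  rw [hd, condVec, conjTranspose_kronecker, ← mul_kronecker_mul, ← mul_kronecker_mul, condRef,
    conjTranspose_one, Matrix.mul_one, Matrix.mul_one, Matrix.mul_add, Matrix.add_mul,
    ← ρ.traceFst.mat_eq, Matrix.mul_smul, Matrix.mul_one, Matrix.smul_mul, hT]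

theorem sum_condVec (ρ : DensityMatrix (m × n)) (f : n → ℝ) :
    ∑ j, ((ρ.condVecᴴ * ρ.mat * ρ.condVec) j j).re * f j.2 =
      ∑ k, ρ.traceFst.eigenvalues k * f k := by
  rw [Fintype.sum_prod_type_right]
  refine Finset.sum_congr rfl fun k _ => ?_
  change ∑ a, ((ρ.condVecᴴ * ρ.mat * ρ.condVec) (a, k) (a, k)).re * f k = _
  rw [← Finset.sum_mul, ← Complex.re_sum]
  congr 1
  have h := congr_fun (congr_fun ρ.traceFst.conjTranspose_eigenvectors_mul_mat_mul k) k
  rw [diagonal_apply_eq] at h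
  rw [← Complex.ofReal_re (ρ.traceFst.eigenvalues k), ← h]
  congr 1
  have hsum : ρ.traceFst.mat = ∑ a, ρ.mat.submatrix (fun i => (a, i)) (fun i => (a, i)) := by
    ext i j
    rw [traceFst_mat_apply, Matrix.sum_apply]
    rfl
  rw [hsum, Matrix.mul_sum, Matrix.sum_mul, Matrix.sum_apply]
  refine Finset.sum_congr rfl fun a _ => ?_
  simp [condVec, conjTranspose_kronecker, mul_apply, conjTranspose_one, kroneckerMap_apply,
    Fintype.sum_prod_type, one_apply]

theorem neg_entropy_add_regEntropy (ρ : DensityMatrix (m × n)) (ε : ℝ) :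
    -ρ.entropy + ρ.traceFst.regEntropy ε = -ρ.entropy -
      ∑ j, ((ρ.condVecᴴ * ρ.mat * ρ.condVec) j j).re *
        Real.log (ρ.traceFst.eigenvalues j.2 + ε) := by
  rw [ρ.sum_condVec fun k => Real.log (ρ.traceFst.eigenvalues k + ε), regEntropy, sub_eq_add_neg]

/-- The factor `k` leaves room for a partial trace, which multiplies `ε` by a dimension. -/
theorem condEntropy_le_of_resolventForm_le (ρ : DensityMatrix (m × n))
    (ρ' : DensityMatrix (m' × n')) {k : ℝ} (hk : 0 < k)
    (h : ∀ ε, 0 < ε → ∀ s Y, ∃ X,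
      resolventForm s ρ'.mat (ρ'.condRef (k * ε)) Y ≤ resolventForm s ρ.mat (ρ.condRef ε) X) :
    ρ.condEntropy ≤ ρ'.condEntropy := by
  have key : ∀ ε, 0 < ε → -ρ'.entropy + ρ'.traceFst.regEntropy (k * ε) ≤
      -ρ.entropy + ρ.traceFst.regEntropy ε := by
    intro ε hε
    rw [neg_entropy_add_regEntropy, neg_entropy_add_regEntropy]
    refine relEntropy_le_of_resolventForm_le ρ ρ' ρ.condVec_mem ρ'.condVec_mem
      (fun i => add_pos_of_nonneg_of_pos (ρ.traceFst.eigenvalues_nonneg _) hε)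
      (fun i => add_pos_of_nonneg_of_pos (ρ'.traceFst.eigenvalues_nonneg _) (mul_pos hk hε))
      fun s _ Y => ?_
    rw [← condRef_eq, ← condRef_eq]
    exact h ε hε s Y
  have hkε : Tendsto (fun ε : ℝ => k * ε) (𝓝[>] 0) (𝓝[>] 0) := by
    refine tendsto_nhdsWithin_iff.2 ⟨?_, ?_⟩
    · have : Tendsto (fun ε : ℝ => k * ε) (𝓝 0) (𝓝 (k * 0)) := tendsto_id.const_mul k
      rw [mul_zero] at this
      exact this.mono_left nhdsWithin_le_nhds
    · filter_upwards [self_mem_nhdsWithin] with ε hε using mul_pos hk hε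
  have hlim := le_of_tendsto_of_tendsto
    ((ρ'.traceFst.tendsto_regEntropy.comp hkε).const_add (-ρ'.entropy))
    (ρ.traceFst.tendsto_regEntropy.const_add (-ρ.entropy))
    (by filter_upwards [self_mem_nhdsWithin] with ε hε using key ε hε)
  rw [condEntropy, condEntropy]
  linarith

end Conditional

end DensityMatrix

/-! ### Strong subadditivity -/

namespace Matrix

variable {m n k : Type*} [Fintype m] [Fintype n] [Fintype k]

theorem trace_submatrix_equiv (e : m ≃ n) (A : Matrix n n ℂ) :
    (A.submatrix e e).trace = A.trace :=
  Equiv.sum_comp e fun i => A i i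

theorem resolventForm_submatrix (e : m ≃ n) (s : ℝ) (ρ σ X : Matrix n n ℂ) :
    resolventForm s (ρ.submatrix e e) (σ.submatrix e e) (X.submatrix e e) =
      resolventForm s ρ σ X := by
  simp only [resolventForm, conjTranspose_submatrix, submatrix_mul_equiv,
    trace_submatrix_equiv]

theorem trace_conjTranspose_mul_self_re {k l : Type*} [Fintype k] [Fintype l]
    (A : Matrix k l ℂ) : (Aᴴ * A).trace.re = ∑ j, ∑ i, ‖A i j‖ ^ 2 := by
  simp only [trace, diag_apply, mul_apply, conjTranspose_apply, Complex.re_sum]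
  refine Finset.sum_congr rfl fun j _ => Finset.sum_congr rfl fun i _ => ?_
  rw [← Complex.normSq_eq_norm_sq, Complex.normSq_apply]
  simp

theorem trace_conjTranspose_mul_sum_le {ι k l : Type*} [Fintype ι] [Fintype k]
    [Fintype l] (A : ι → Matrix k l ℂ) : ((∑ a, A a)ᴴ * (∑ a, A a)).trace.re ≤
      Fintype.card ι * ∑ a, ((A a)ᴴ * A a).trace.re := by
  simp only [trace_conjTranspose_mul_self_re]
  rw [Finset.sum_comm (γ := ι), Finset.mul_sum]
  refine Finset.sum_le_sum fun j _ => ?_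
  rw [Finset.sum_comm, Finset.mul_sum]
  refine Finset.sum_le_sum fun i _ => ?_
  rw [Matrix.sum_apply]
  calc ‖∑ a, A a i j‖ ^ 2 ≤ (∑ a, ‖A a i j‖) ^ 2 :=
        pow_le_pow_left₀ (norm_nonneg _) (norm_sum_le _ _) 2
    _ ≤ _ := sq_sum_le_card_mul_sum_sq

/-- Partial trace over the second factor, for an arbitrary matrix. -/
def partialTrace (A : Matrix (m × k) (m × k) ℂ) : Matrix m m ℂ :=
  of fun i j => ∑ c, A (i, c) (j, c)

variable [DecidableEq k]

theorem trace_kronecker_one_mul (Z : Matrix m m ℂ) (A : Matrix (m × k) (m × k) ℂ) :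
    ((Z ⊗ₖ (1 : Matrix k k ℂ)) * A).trace = (Z * A.partialTrace).trace := by
  simp only [trace, diag_apply, mul_apply, kroneckerMap_apply, partialTrace, of_apply,
    Fintype.sum_prod_type, one_apply, Finset.mul_sum]
  refine Finset.sum_congr rfl fun i _ => ?_
  rw [Finset.sum_comm]
  refine Finset.sum_congr rfl fun j _ => Finset.sum_congr rfl fun c _ => ?_
  simp

/-- The functional of the partial traces is the restriction of the functional to the matrices
`Y ⊗ 1`. Hence its maximum does not increase under a partial trace: this is the data processing
inequality. -/
theorem resolventForm_partialTrace (s : ℝ) (ρ σ : Matrix (m × k) (m × k) ℂ) (Y : Matrix m m ℂ) :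
    resolventForm s ρ.partialTrace σ.partialTrace Y =
      resolventForm s ρ σ (Y ⊗ₖ (1 : Matrix k k ℂ)) := by
  have h1 : ((Y ⊗ₖ (1 : Matrix k k ℂ))ᴴ * ρ).trace = (Yᴴ * ρ.partialTrace).trace := by
    rw [conjTranspose_kronecker, conjTranspose_one, trace_kronecker_one_mul]
  have h2 : ((Y ⊗ₖ (1 : Matrix k k ℂ))ᴴ * σ * (Y ⊗ₖ (1 : Matrix k k ℂ))).trace =
      (Yᴴ * σ.partialTrace * Y).trace := by
    rw [trace_mul_cycle, trace_mul_cycle Yᴴ, conjTranspose_kronecker, conjTranspose_one,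
      ← mul_kronecker_mul, Matrix.mul_one, trace_kronecker_one_mul]
  have h3 : ((Y ⊗ₖ (1 : Matrix k k ℂ)) * ρ * (Y ⊗ₖ (1 : Matrix k k ℂ))ᴴ).trace =
      (Y * ρ.partialTrace * Yᴴ).trace := by
    rw [trace_mul_cycle, trace_mul_cycle Y, conjTranspose_kronecker, conjTranspose_one,
      ← mul_kronecker_mul, Matrix.mul_one, trace_kronecker_one_mul]
  rw [resolventForm, resolventForm, h1, h2, h3]

end Matrix

namespace DensityMatrix

section SSA

variable {a b c : Type*} [Fintype a] [Fintype b] [Fintype c] [DecidableEq a] [DecidableEq b]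
  [DecidableEq c]

/-- Strong subadditivity, in the form `H(a|bc) ≤ H(a|b)`. -/
theorem condEntropy_le_condEntropy_traceSnd (ρ : DensityMatrix (a × (b × c))) :
    ρ.condEntropy ≤ (ρ.relabel (Equiv.prodAssoc a b c).symm).traceSnd.condEntropy := by
  have hc : 0 < (Fintype.card c : ℝ) := by
    obtain ⟨x⟩ := ρ.nonempty
    exact_mod_cast Fintype.card_pos_iff.2 ⟨x.2.2⟩
  set e := Equiv.prodAssoc a b c
  set ρ' := (ρ.relabel e.symm).traceSnd with hρ'
  have h1 : ρ'.mat = (ρ.mat.submatrix e e).partialTrace := by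
    ext i j
    rw [hρ', traceSnd_mat_apply]
    rfl
  have h2 : ∀ ε : ℝ, ρ'.condRef (Fintype.card c * ε) =
      ((ρ.condRef ε).submatrix e e).partialTrace := by
    intro ε
    ext ⟨i, j⟩ ⟨i', j'⟩
    -- `Tr_c (1_a ⊗ (ρ_bc + ε)) = 1_a ⊗ (ρ_b + |c| ε)`, entry by entry.
    have hl : ρ'.traceFst.mat j j' = ∑ x, ρ.traceFst.mat (j, x) (j', x) := by
      simp only [traceFst_mat_apply, h1, partialTrace, of_apply, submatrix_apply]
      exact Finset.sum_comm
    have hr : (Fintype.card c : ℂ) * (1 : Matrix b b ℂ) j j' =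
        ∑ x : c, (1 : Matrix (b × c) (b × c) ℂ) (j, x) (j', x) := by
      simp [one_apply]
    change (1 : Matrix a a ℂ) i i' * (ρ'.traceFst.mat j j' +
      ((Fintype.card c * ε : ℝ) : ℂ) * (1 : Matrix b b ℂ) j j') =
      ∑ x, (1 : Matrix a a ℂ) i i' * (ρ.traceFst.mat (j, x) (j', x) +
        (ε : ℂ) * (1 : Matrix (b × c) (b × c) ℂ) (j, x) (j', x))
    rw [← Finset.mul_sum, Finset.sum_add_distrib, ← Finset.mul_sum, ← hl, ← hr]
    push_cast
    ring
  refine condEntropy_le_of_resolventForm_le ρ ρ' hc fun ε _ s Y =>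
    ⟨(Y ⊗ₖ (1 : Matrix c c ℂ)).submatrix e.symm e.symm, ?_⟩
  rw [h1, h2, resolventForm_partialTrace, ← resolventForm_submatrix e s ρ.mat]
  simp [submatrix_submatrix]

end SSA

/-! ### Bounds on the conditional entropy -/

section Bounds

variable {m n : Type*} [Fintype m] [Fintype n] [DecidableEq m] [DecidableEq n]

/-- An upper bound that does not depend on the conditioning system; it is strong subadditivity with
a trivial middle system, followed by a crude bound on the entropy. -/
theorem condEntropy_le_card (ρ : DensityMatrix (m × n)) : ρ.condEntropy ≤ Fintype.card m := by
  have h := condEntropy_le_condEntropy_traceSnd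
    (ρ.relabel ((Equiv.refl m).prodCongr (Equiv.punitProd.{0} n).symm))
  refine le_trans (le_of_eq ?_) (h.trans ?_)
  · rw [condEntropy, condEntropy, entropy_relabel]
    congr 1
    have : (ρ.relabel ((Equiv.refl m).prodCongr (Equiv.punitProd.{0} n).symm)).traceFst =
        ρ.traceFst.relabel (Equiv.punitProd.{0} n).symm := by
      ext i j
      simp [traceFst, traceSnd, relabel, Matrix.sum_apply]
    rw [this, entropy_relabel]
  · rw [condEntropy]
    refine (sub_le_self _ (entropy_nonneg _)).trans ((entropy_le_card _).trans ?_)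
    simp

open scoped MatrixOrder in
/-- The operator inequality `ρ ≤ |m| • (1 ⊗ Tr_m ρ)`, tested against `X Xᴴ`. With `ρ = Mᴴ M` and
`M` cut into `|m|` blocks of columns, it is the Cauchy–Schwarz inequality for a sum of `|m|`
matrices in the Hilbert–Schmidt norm. -/
theorem trace_conj_mat_le (ρ : DensityMatrix (m × n)) (X : Matrix (m × n) (m × n) ℂ) :
    (Xᴴ * ρ.mat * X).trace.re ≤
      Fintype.card m * (Xᴴ * ((1 : Matrix m m ℂ) ⊗ₖ ρ.traceFst.mat) * X).trace.re := by
  obtain ⟨M, hM⟩ : ∃ M : Matrix (m × n) (m × n) ℂ, ρ.mat = Mᴴ * M := by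
    have h := ρ.posSemidef
    exact CStarAlgebra.nonneg_iff_eq_star_mul_self.1 (Matrix.nonneg_iff_posSemidef.2 h)
  set R : m → Matrix (m × n) n ℂ := fun b => M.submatrix id fun i => (b, i) with hR
  set Z : m → Matrix n (m × n) ℂ := fun a => X.submatrix (fun i => (a, i)) id with hZ
  have hMX : M * X = ∑ a, R a * Z a := by
    ext i j
    simp [mul_apply, Matrix.sum_apply, Fintype.sum_prod_type, hR, hZ]
  have hτ : ρ.traceFst.mat = ∑ b, (R b)ᴴ * R b := by
    ext i j
    rw [traceFst_mat_apply, hM]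
    simp [mul_apply, Matrix.sum_apply, hR]
  have hX : Xᴴ * ((1 : Matrix m m ℂ) ⊗ₖ ρ.traceFst.mat) * X =
      ∑ a, (Z a)ᴴ * ρ.traceFst.mat * Z a := by
    ext i j
    simp [mul_apply, Matrix.sum_apply, Fintype.sum_prod_type, hZ, kroneckerMap_apply, one_apply]
  have hl : Xᴴ * ρ.mat * X = (∑ a, R a * Z a)ᴴ * ∑ a, R a * Z a := by
    rw [← hMX, conjTranspose_mul, hM]
    simp only [Matrix.mul_assoc]
  rw [hl, hX, trace_sum, Complex.re_sum]
  refine (trace_conjTranspose_mul_sum_le _).trans ?_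
  refine mul_le_mul_of_nonneg_left (Finset.sum_le_sum fun a _ => ?_) (Nat.cast_nonneg _)
  have : (Z a)ᴴ * ρ.traceFst.mat * Z a = ∑ b, (R b * Z a)ᴴ * (R b * Z a) := by
    rw [hτ, Matrix.mul_sum, Matrix.sum_mul]
    simp only [conjTranspose_mul, Matrix.mul_assoc]
  rw [this, trace_sum, Complex.re_sum]
  refine Finset.single_le_sum (f := fun b => ((R b * Z a)ᴴ * (R b * Z a)).trace.re)
    (fun b _ => ?_) (Finset.mem_univ a)
  rw [trace_conjTranspose_mul_self_re]
  positivity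

/-- Since `1 ⊗ (ρ_n + ε) ≥ (ρ + ε) / |m|`, the relative entropy of `ρ` to the former is at most that
to the latter, which tends to `log |m|`. -/
theorem neg_log_card_le_condEntropy (ρ : DensityMatrix (m × n)) :
    -Real.log (Fintype.card m) ≤ ρ.condEntropy := by
  have hd : (1 : ℝ) ≤ Fintype.card m := by
    obtain ⟨x⟩ := ρ.nonempty
    exact_mod_cast Fintype.card_pos_iff.2 ⟨x.1⟩
  have hd0 : (0 : ℝ) < Fintype.card m := by linarith
  set d : ℝ := (Fintype.card m : ℝ)
  have key : ∀ ε, 0 < ε → -ρ.entropy + ρ.traceFst.regEntropy ε ≤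
      -ρ.entropy + (ρ.regEntropy ε + Real.log d) := by
    intro ε hε
    have h1 : ∀ i, 0 < (ρ.eigenvalues i + ε) / d := fun i =>
      div_pos (add_pos_of_nonneg_of_pos (ρ.eigenvalues_nonneg i) hε) hd0
    have h2 : ρ.regEntropy ε + Real.log d =
        -∑ j, ((ρ.eigenvectorsᴴ * ρ.mat * ρ.eigenvectors) j j).re *
          Real.log ((ρ.eigenvalues j + ε) / d) := by
      have : ∀ j, ((ρ.eigenvectorsᴴ * ρ.mat * ρ.eigenvectors) j j).re *
          Real.log ((ρ.eigenvalues j + ε) / d) =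
          ρ.eigenvalues j * Real.log (ρ.eigenvalues j + ε) - ρ.eigenvalues j * Real.log d := by
        intro j
        rw [conjTranspose_eigenvectors_mul_mat_mul, diagonal_apply_eq, Complex.ofReal_re,
          Real.log_div (add_pos_of_nonneg_of_pos (ρ.eigenvalues_nonneg j) hε).ne' hd0.ne', mul_sub]
      simp only [this]
      rw [Finset.sum_sub_distrib, ← Finset.sum_mul, sum_eigenvalues, regEntropy]
      ring
    rw [neg_entropy_add_regEntropy, h2, ← sub_eq_add_neg]
    refine relEntropy_le_of_resolventForm_le ρ ρ ρ.eigenvectors_mem ρ.condVec_mem h1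
      (fun i => add_pos_of_nonneg_of_pos (ρ.traceFst.eigenvalues_nonneg _) hε)
      fun s _ Y => ⟨Y, ?_⟩
    rw [← condRef_eq]
    have hσ : ρ.eigenvectors * diagonal (fun i => (((ρ.eigenvalues i + ε) / d : ℝ) : ℂ)) *
        ρ.eigenvectorsᴴ = ((d⁻¹ : ℝ) : ℂ) • (ρ.mat + (ε : ℂ) • (1 : Matrix (m × n) (m × n) ℂ)) := by
      have : diagonal (fun i => (((ρ.eigenvalues i + ε) / d : ℝ) : ℂ)) = ((d⁻¹ : ℝ) : ℂ) •
          (diagonal (fun i => (ρ.eigenvalues i : ℂ)) +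
            (ε : ℂ) • (1 : Matrix (m × n) (m × n) ℂ)) := by
        rw [← diagonal_one, ← diagonal_smul, diagonal_add, ← diagonal_smul]
        congr 1
        ext i
        simp
        ring
      have hU : ρ.eigenvectors * ρ.eigenvectorsᴴ = 1 := mem_unitaryGroup_iff.1 ρ.eigenvectors_mem
      rw [this, Matrix.mul_smul, Matrix.smul_mul, Matrix.mul_add, Matrix.add_mul, ← ρ.mat_eq,
        Matrix.mul_smul, Matrix.mul_one, Matrix.smul_mul, hU]
    have e1 : (Yᴴ * ρ.condRef ε * Y).trace.re =
        (Yᴴ * ((1 : Matrix m m ℂ) ⊗ₖ ρ.traceFst.mat) * Y).trace.re + ε * (Yᴴ * Y).trace.re := by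
      rw [condRef, kronecker_add, kronecker_smul, one_kronecker_one, Matrix.mul_add,
        Matrix.add_mul, Matrix.mul_smul, Matrix.mul_one, Matrix.smul_mul, trace_add, trace_smul,
        Complex.add_re, smul_eq_mul, Complex.re_ofReal_mul]
    have e2 : (Yᴴ * (((d⁻¹ : ℝ) : ℂ) • (ρ.mat + (ε : ℂ) • (1 : Matrix (m × n) (m × n) ℂ))) *
        Y).trace.re = d⁻¹ * ((Yᴴ * ρ.mat * Y).trace.re + ε * (Yᴴ * Y).trace.re) := by
      rw [Matrix.mul_smul, Matrix.smul_mul, trace_smul, smul_eq_mul, Complex.re_ofReal_mul,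
        Matrix.mul_add, Matrix.add_mul, Matrix.mul_smul, Matrix.mul_one, Matrix.smul_mul,
        trace_add, trace_smul, Complex.add_re, smul_eq_mul, Complex.re_ofReal_mul]
    have h3 : 0 ≤ (Yᴴ * Y).trace.re := by
      rw [trace_conjTranspose_mul_self_re]
      positivity
    have h4 : d⁻¹ * (Yᴴ * ρ.mat * Y).trace.re ≤
        (Yᴴ * ((1 : Matrix m m ℂ) ⊗ₖ ρ.traceFst.mat) * Y).trace.re := by
      rw [inv_mul_le_iff₀ hd0]
      exact ρ.trace_conj_mat_le Y
    have h5 : d⁻¹ * (ε * (Yᴴ * Y).trace.re) ≤ ε * (Yᴴ * Y).trace.re :=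
      mul_le_of_le_one_left (mul_nonneg hε.le h3) (inv_le_one_of_one_le₀ hd)
    rw [hσ, resolventForm, resolventForm, e1, e2]
    linarith
  have hlim := le_of_tendsto_of_tendsto
    (ρ.traceFst.tendsto_regEntropy.const_add (-ρ.entropy))
    ((ρ.tendsto_regEntropy.add_const (Real.log d)).const_add (-ρ.entropy))
    (by filter_upwards [self_mem_nhdsWithin] with ε hε using key ε hε)
  rw [condEntropy]
  linarith

end Bounds
end DensityMatrix

namespace DensityMatrix

/-! ### Regrouping of tensor factors -/

section Relabel

variable {x m n k k' m' n' : Type*} [Fintype x] [Fintype m] [Fintype n] [Fintype k] [Fintype k']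
  [Fintype m'] [Fintype n']

/-- A partial trace depends on the splitting `e` only through the factor that is kept and the
partition of the labels by the factor that is traced out, not through the names of the latter. -/
theorem traceSnd_relabel_congr (ρ : DensityMatrix x) (e : x ≃ n × k) (e' : x ≃ n × k')
    (h1 : ∀ a, (e a).1 = (e' a).1) (h2 : ∀ a b, (e a).2 = (e b).2 ↔ (e' a).2 = (e' b).2) :
    (ρ.relabel e).traceSnd = (ρ.relabel e').traceSnd := by
  ext i j
  rw [traceSnd_mat_apply, traceSnd_mat_apply]
  have hsymm : ∀ (i : n) (c : k), e' (e.symm (i, c)) = (i, (e' (e.symm (i, c))).2) := fun i c =>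
    Prod.ext (by rw [← h1, Equiv.apply_symm_apply]) rfl
  have hindep : ∀ c, (e' (e.symm (j, c))).2 = (e' (e.symm (i, c))).2 := fun c => by
    rw [← h2, Equiv.apply_symm_apply, Equiv.apply_symm_apply]
  -- The labels of the traced-out factor in the two splittings correspond bijectively.
  refine Fintype.sum_equiv (Equiv.ofBijective (fun c => (e' (e.symm (i, c))).2)
    ⟨fun c d hcd => ?_, fun d => ⟨(e (e'.symm (i, d))).2, ?_⟩⟩) _ _ fun c => ?_
  · have := (h2 _ _).2 hcd
    rwa [Equiv.apply_symm_apply, Equiv.apply_symm_apply] at this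
  · have : (i, (e (e'.symm (i, d))).2) = e (e'.symm (i, d)) :=
      Prod.ext (by rw [h1, Equiv.apply_symm_apply]) rfl
    change (e' (e.symm _)).2 = d
    rw [this, Equiv.symm_apply_apply, Equiv.apply_symm_apply]
  · change ρ.mat (e.symm (i, c)) (e.symm (j, c)) =
      ρ.mat (e'.symm (i, (e' (e.symm (i, c))).2)) (e'.symm (j, (e' (e.symm (i, c))).2))
    rw [← hsymm, Equiv.symm_apply_apply, ← hindep, ← hsymm, Equiv.symm_apply_apply]

theorem traceSnd_relabel (ρ : DensityMatrix (m × n)) (f : m ≃ m') :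
    ρ.traceSnd.relabel f = (ρ.relabel (f.prodCongr (Equiv.refl n))).traceSnd := by
  ext i j
  simp [traceSnd, relabel, Matrix.sum_apply]

theorem traceSnd_traceSnd (ρ : DensityMatrix ((m × n) × k)) :
    ρ.traceSnd.traceSnd = (ρ.relabel (Equiv.prodAssoc m n k)).traceSnd := by
  ext i j
  simp [traceSnd, relabel, Matrix.sum_apply, Fintype.sum_prod_type]

theorem relabel_relabel (ρ : DensityMatrix m) (e : m ≃ n) (f : n ≃ k) :
    (ρ.relabel e).relabel f = ρ.relabel (e.trans f) := rfl

theorem traceFst_relabel_prodCongr (ρ : DensityMatrix (m × n)) (e : m ≃ m') (f : n ≃ n') :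
    (ρ.relabel (e.prodCongr f)).traceFst = ρ.traceFst.relabel f := by
  ext i j
  simp only [traceFst_mat_apply, relabel, submatrix_apply]
  exact Equiv.sum_comp e.symm fun a => ρ.mat (a, f.symm i) (a, f.symm j)

theorem condEntropy_relabel [DecidableEq m] [DecidableEq n] [DecidableEq m'] [DecidableEq n']
    (ρ : DensityMatrix (m × n)) (e : m ≃ m') (f : n ≃ n') :
    (ρ.relabel (e.prodCongr f)).condEntropy = ρ.condEntropy := by
  rw [condEntropy, traceFst_relabel_prodCongr, entropy_relabel, entropy_relabel, condEntropy]

end Relabel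

/-! ### Squashed entanglement and CEMI -/

section Multipartite

variable {l : ℕ} {α β : Fin l → Type*} [∀ i, Fintype (α i)] [∀ i, DecidableEq (α i)]
  [∀ i, Fintype (β i)] [∀ i, DecidableEq (β i)] {ε : Type*} [Fintype ε] [DecidableEq ε]

/-- The state of `A₁A₁' ⋯ A_lA_l'` seen as a state of `A₁ ⋯ A_l E`, where `E = A₁' ⋯ A_l'`. The
labels of `E` are renamed along `g`, since extensions are indexed by `Fin e`. -/
def groupPrimed (σ : DensityMatrix (∀ j, α j × β j)) (g : (∀ j, β j) ≃ ε) :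
    DensityMatrix ((∀ j, α j) × ε) :=
  σ.relabel ((Equiv.arrowProdEquivProdArrow (Fin l) α β).trans ((Equiv.refl _).prodCongr g))

omit [∀ i, DecidableEq (α i)] [∀ i, DecidableEq (β i)] [DecidableEq ε] in
theorem traceSnd_groupPrimed (σ : DensityMatrix (∀ j, α j × β j)) (g : (∀ j, β j) ≃ ε) :
    (σ.groupPrimed g).traceSnd = σ.unprimed :=
  traceSnd_relabel_congr _ _ _ (fun _ => rfl) fun a b => by simp

theorem condEntropy_groupPrimed (σ : DensityMatrix (∀ j, α j × β j)) (g : (∀ j, β j) ≃ ε) :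
    (σ.groupPrimed g).condEntropy = σ.entropy - σ.primed.entropy := by
  rw [groupPrimed, ← relabel_relabel, condEntropy_relabel, condEntropy, entropy_relabel]
  rfl

/-- Regrouping `A₁A₁' ⋯ A_lA_l'` as `(Aᵢ (Aᵢ' R')) R`, where `R'` and `R` consist of the `A_j'` and
of the `A_j` with `j ≠ i`. -/
def splitPrimed (α β : Fin l → Type*) (i : Fin l) : (∀ j, α j × β j) ≃
    (α i × (β i × ∀ j : {j // j ≠ i}, β j)) × (∀ j : {j // j ≠ i}, α j) :=
  (Equiv.arrowProdEquivProdArrow (Fin l) α β).trans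
    (((Equiv.refl _).prodCongr (Equiv.piSplitAt i β)).trans (splitAtWith α _ i))

/-- `H(Aᵢ | A₁' ⋯ A_l') ≤ H(Aᵢ | Aᵢ')`: strong subadditivity, conditioning on more systems. -/
theorem condEntropy_marginalWith_le (σ : DensityMatrix (∀ j, α j × β j)) (g : (∀ j, β j) ≃ ε)
    (i : Fin l) : ((σ.groupPrimed g).marginalWith i).condEntropy ≤
      (σ.marginal i).entropy - (σ.primed.marginal i).entropy := by
  have h1 : (σ.groupPrimed g).marginalWith i = (σ.relabel (splitPrimed α β i)).traceSnd.relabel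
      ((Equiv.refl _).prodCongr ((Equiv.piSplitAt i β).symm.trans g)) := by
    rw [traceSnd_relabel, relabel_relabel, marginalWith, groupPrimed, relabel_relabel]
    refine traceSnd_relabel_congr _ _ _ (fun a => ?_) fun a b => ?_
    · refine Prod.ext rfl ?_
      exact (congrArg g (Equiv.symm_apply_apply (Equiv.piSplitAt i β) fun j => (a j).2)).symm
    · rfl
  have h2 : ((σ.relabel (splitPrimed α β i)).traceSnd.relabel
      (Equiv.prodAssoc _ _ _).symm).traceSnd = σ.marginal i := by
    rw [traceSnd_relabel, traceSnd_traceSnd, relabel_relabel, relabel_relabel, marginal]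
    refine traceSnd_relabel_congr _ _ _ (fun a => rfl) fun a b => ?_
    simp [splitPrimed, splitAtWith, Equiv.arrowProdEquivProdArrow, funext_iff, Prod.ext_iff]
    exact ⟨fun h k hk => ⟨h.2 k hk, h.1 k hk⟩,
      fun h => ⟨fun k hk => (h k hk).2, fun k hk => (h k hk).1⟩⟩
  have h3 : (σ.marginal i).traceFst = σ.primed.marginal i := by
    rw [marginal, traceFst, traceSnd_relabel, traceSnd_traceSnd, relabel_relabel, relabel_relabel,
      marginal, primed, traceFst, traceSnd_relabel, traceSnd_traceSnd, relabel_relabel, relabel_relabel,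
      relabel_relabel]
    refine traceSnd_relabel_congr _ _ _ (fun a => rfl) fun a b => ?_
    simp [Equiv.arrowProdEquivProdArrow, funext_iff, Prod.ext_iff]
    grind
  rw [h1, condEntropy_relabel]
  refine (condEntropy_le_condEntropy_traceSnd _).trans (le_of_eq ?_)
  rw [h2, condEntropy, h3]

/-- Extending by `E = A₁' ⋯ A_l'`, the difference of the two sides is
`∑ᵢ (H(Aᵢ | Aᵢ') - H(Aᵢ | A₁' ⋯ A_l'))`. -/
theorem condMultiInfo_groupPrimed_le (σ : DensityMatrix (∀ j, α j × β j)) (g : (∀ j, β j) ≃ ε) :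
    (σ.groupPrimed g).condMultiInfo ≤ σ.multiInfo - σ.primed.multiInfo := by
  have h := Finset.sum_le_sum fun i (_ : i ∈ Finset.univ) => σ.condEntropy_marginalWith_le g i
  rw [Finset.sum_sub_distrib] at h
  rw [condMultiInfo, condEntropy_groupPrimed, multiInfo, multiInfo]
  linarith

/-- A lower bound that does not depend on `E`. -/
theorem le_condMultiInfo (σ : DensityMatrix ((∀ j, α j) × ε)) :
    -∑ i, Real.log (Fintype.card (α i)) - Fintype.card (∀ j, α j) ≤ σ.condMultiInfo := by
  rw [condMultiInfo, ← Finset.sum_neg_distrib]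
  exact sub_le_sub (Finset.sum_le_sum fun i _ => neg_log_card_le_condEntropy _)
    σ.condEntropy_le_card

theorem squashedValues_nonempty (ρ : DensityMatrix (∀ j, α j)) : ρ.squashedValues.Nonempty := by
  refine ⟨_, 1, ρ.relabel (Equiv.prodUnique _ (Fin 1)).symm, ?_, rfl⟩
  ext i j
  simp [traceSnd_mat_apply, relabel]

theorem cemiValues_nonempty (ρ : DensityMatrix (∀ j, α j)) : ρ.cemiValues.Nonempty := by
  refine ⟨_, fun _ => 1,
    ρ.relabel (Equiv.piCongrRight fun i => (Equiv.prodUnique (α i) (Fin 1)).symm), ?_, rfl⟩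
  ext i j
  rw [unprimed, traceSnd_mat_apply]
  simp [relabel]
  rfl

theorem exists_squashedValues_le (ρ : DensityMatrix (∀ j, α j)) {y : ℝ} (hy : y ∈ ρ.cemiValues) :
    ∃ z ∈ ρ.squashedValues, z ≤ y := by
  obtain ⟨d, σ, rfl, rfl⟩ := hy
  exact ⟨_, ⟨_, σ.groupPrimed (Fintype.equivFin _), traceSnd_groupPrimed _ _, rfl⟩,
    condMultiInfo_groupPrimed_le _ _⟩

theorem squashedValues_bddBelow (ρ : DensityMatrix (∀ j, α j)) : BddBelow ρ.squashedValues := by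
  refine ⟨-∑ i, Real.log (Fintype.card (α i)) - Fintype.card (∀ j, α j), ?_⟩
  rintro _ ⟨e, σ, -, rfl⟩
  exact σ.le_condMultiInfo

theorem cemiValues_bddBelow (ρ : DensityMatrix (∀ j, α j)) : BddBelow ρ.cemiValues := by
  obtain ⟨b, hb⟩ := ρ.squashedValues_bddBelow
  refine ⟨b, fun y hy => ?_⟩
  obtain ⟨z, hz, hzy⟩ := ρ.exists_squashedValues_le hy
  exact (hb hz).trans hzy

end Multipartite

end DensityMatrix

end

/-- The two sets over which the infima are taken are nonempty and bounded below, so that the infima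
are genuine real numbers, and `E_sq(A₁ : ⋯ : A_l)_ρ ≤ E_I(A₁ : ⋯ : A_l)_ρ`. -/
theorem mainTheorem5 {l : ℕ} {α : Fin l → Type*} [∀ i, Fintype (α i)] [∀ i, DecidableEq (α i)]
    (ρ : DensityMatrix (∀ i, α i)) :
    (ρ.squashedValues.Nonempty ∧ BddBelow ρ.squashedValues) ∧
    (ρ.cemiValues.Nonempty ∧ BddBelow ρ.cemiValues) ∧
    ρ.squashedEntanglement ≤ ρ.cemi := by
  refine ⟨⟨ρ.squashedValues_nonempty, ρ.squashedValues_bddBelow⟩,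
    ⟨ρ.cemiValues_nonempty, ρ.cemiValues_bddBelow⟩, ?_⟩
  refine mul_le_mul_of_nonneg_left ?_ (by norm_num)
  refine le_csInf ρ.cemiValues_nonempty fun y hy => ?_
  obtain ⟨z, hz, hzy⟩ := ρ.exists_squashedValues_le hy
  exact (csInf_le ρ.squashedValues_bddBelow hz).trans hzy
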